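/- Setting. Let $\mathcal X$ be a Borel subset of $\mathbb R^d$, $\mu$ a probability measure on $\mathcal X$, and let $f,f_1,\dots,f_M:\mathcal X\to\mathbb R$ be measurable with $|f|\le L$ and $|f_j|\le L$ on $\mathcal X$. One observes $Y_i=f(X_i)+W_i$, $i=1,\dots,n$, where $X_1,\dots,X_n$ are i.i.d. with law $\mu$ and the errors $W_1,\dots,W_n$ are i.i.d. $N(0,\sigma^2)$, $\sigma>0$, independent of $(X_1,\dots,X_n)$. Write $\|g\|^2=\int g^2\,d\mu$. For $\lambda\in\mathbb R^M$ let ${\sf f}_\lambda=\sum_{j=1}^M\lambda_jf_j$, let $M(\lambda)$ be the number of non-zero coordinates of $\lambda$, and for $K_1>0$ put $$\widehat S(\lambda)=\frac1n\sum_{i=1}^n\{Y_i-{\sf f}_\lambda(X_i)\}^2,\qquad \mathrm{pen}(\lambda)=K_1\frac{M(\lambda)}{n}\log\Bigl(1+\frac{M\vee n}{M(\lambda)\vee1}\Bigr).$$ For $T\ge1$ let $\widetilde f={\sf f}_{\widehat\lambda}$, where $\widehat\lambda$ is any measurable minimizer of $\widehat S(\lambda)+\mathrm{pen}(\lambda)$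 over $\{\lambda\in\mathbb R^M:\sum_{j=1}^M|\lambda_j|\le T\}$, and set $B=L^2(T+1)^2$. Corollary 3.7 [MS]. There is a threshold $K^*=K^*(\varepsilon,B,\sigma^2)>0$, depending on nothing else, such that for every $R\ge1$ there is a constant $c>0$, depending only on $R$, with the following property. For all $\varepsilon>0$, $\sigma>0$, $T\ge1$ and $L$, for every $K_1$ that is large enough and of the order of the threshold, namely $K^*(\varepsilon,B,\sigma^2)\le K_1\le R\,K^*(\varepsilon,B,\sigma^2)$, for all integers $n\ge1$, $M\ge2$, $d\ge 0$ and all $\mathcal X,\mu,f,f_1,\dots,f_M$ as above, $$\mathbb E\,\|\widetilde f-f\|^2\le(1+\varepsilon)\min_{1\le j\le M}\|f_j-f\|^2+C\,\sigma^2\Bigl(1+\frac1\varepsilon\Bigr)\frac{\log(M\vee n)}{n},\qquad C=c\Bigl(1+\frac{B}{\sigma^2}\Bigr),$$ where $\|\widetilde f-f\|^2$ is integrable. -/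

import Mathlib

open MeasureTheory ProbabilityTheory

noncomputable section

namespace Aggregation

/-- The linear combination `f_lam = ∑ j, lam j * f_j` of the functions `f_1, …, f_M`. -/
def linComb {S : Type*} {M : ℕ} (fs : Fin M → S → ℝ) (lam : Fin M → ℝ) (x : S) : ℝ :=
  ∑ j, lam j * fs j x

/-- `M(lam)`: the number of non-zero coordinates of `lam`. -/
def numNonzero {M : ℕ} (lam : Fin M → ℝ) : ℕ :=
  (Finset.univ.filter fun j => lam j ≠ 0).card

/-- The `ℓ¹`-ball `Λ_{M,T}`. -/
def l1Ball (M : ℕ) (T : ℝ) : Set (Fin M → ℝ) :=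
  {lam | ∑ j, |lam j| ≤ T}

/-- The residual sum of squares `n⁻¹ ∑ i, (Y_i - f_lam(X_i))²` of the sample
`(x_1, y_1), …, (x_n, y_n)`. -/
def residual {S : Type*} {n M : ℕ} (fs : Fin M → S → ℝ) (x : Fin n → S) (y : Fin n → ℝ)
    (lam : Fin M → ℝ) : ℝ :=
  (1 / (n : ℝ)) * ∑ i, (y i - linComb fs lam (x i)) ^ 2

/-- The hard threshold penalty for random design,
`K₁ (M(lam) / n) log (1 + (M ∨ n) / (M(lam) ∨ 1))`. -/
def penalty (K₁ : ℝ) (n : ℕ) {M : ℕ} (lam : Fin M → ℝ) : ℝ :=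
  K₁ * ((numNonzero lam : ℝ) / (n : ℝ)) *
    Real.log (1 + max (M : ℝ) (n : ℝ) / max (numNonzero lam : ℝ) 1)

/-- `lam` is a penalized least squares estimate: it minimizes `residual + penalty` over the
`ℓ¹`-ball of radius `T`. -/
def IsPenalizedLSE {S : Type*} {n M : ℕ} (K₁ T : ℝ) (fs : Fin M → S → ℝ)
    (x : Fin n → S) (y : Fin n → ℝ) (lam : Fin M → ℝ) : Prop :=
  lam ∈ l1Ball M T ∧
    ∀ lam' ∈ l1Ball M T,
      residual fs x y lam + penalty K₁ n lam ≤ residual fs x y lam' + penalty K₁ n lam'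

/-- The squared `L²(μ)` norm `‖g‖² = ∫ g² dμ`. -/
def l2NormSq {S : Type*} [MeasurableSpace S] (μ : Measure S) (g : S → ℝ) : ℝ :=
  ∫ x, g x ^ 2 ∂μ

/-- Gaussian regression with random design: the design points `X_i` are i.i.d. with law `μ`, the
errors `W_i` are i.i.d. `N(0, σ²)`, and the errors are independent of the design. -/
structure IsGaussianRandomDesign {Ω S : Type*} [MeasurableSpace Ω] [MeasurableSpace S] {n : ℕ}
    (P : Measure Ω) (μ : Measure S) (σ : ℝ) (X : Fin n → Ω → S) (W : Fin n → Ω → ℝ) : Prop where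
  measurable_design : ∀ i, Measurable (X i)
  law_design : ∀ i, P.map (X i) = μ
  indep_design : iIndepFun X P
  measurable_error : ∀ i, Measurable (W i)
  law_error : ∀ i, P.map (W i) = gaussianReal 0 (Real.toNNReal (σ ^ 2))
  indep_error : iIndepFun W P
  indep_design_error : IndepFun (fun ω i => X i ω) (fun ω i => W i ω) P

end Aggregation

end

/-! With g = f_λ − f, the residual equals a noise term free of λ plus the contrast n⁻¹ ∑ (g(X_i)² −
2 W_i g(X_i)), whose mean is ‖g‖². It suffices to bound the `deviation` ‖g‖² − (1+ε)·contrast by the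
penalty, uniformly over the ℓ¹-ball, up to a remainder of small mean: minimality then compares the
estimate with each vertex e_j, which lies in the ball since T ≥ 1.

For one g bounded by b, the extra ε g² absorbs both the Gaussian variance and the second-order term,
so exp(n t · deviation) has mean at most 1 for t = ε / (16(σ² + b²))
(`lintegral_exp_deviation_le_one`). Uniformity comes from a union bound over the points T a / n,
with a integral of ℓ¹-norm at most n. A Chernoff count (`card_intSupport_eq_le`) shows that the
weights exp(−7 · complexity) sum to at most 2.

Rounding towards zero never enlarges the support, so its error is of order k / n for k non-zero
coefficients. Half of the penalty pays for the union bound and half for the rounding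
(`deviation_sub_penalty_le`). -/

namespace Aggregation

/-! ### Gaussian exponential moments and factorization over observations. -/

lemma lintegral_exp_mul_gaussianReal (v : NNReal) (s : ℝ) :
    ∫⁻ w, ENNReal.ofReal (Real.exp (s * w)) ∂gaussianReal 0 v
      = ENNReal.ofReal (Real.exp (v * s ^ 2 / 2)) := by
  rw [← ofReal_integral_eq_lintegral_ofReal (integrable_exp_mul_gaussianReal s)
    (ae_of_all _ fun w => (Real.exp_pos _).le)]
  have h := congrFun (mgf_id_gaussianReal (μ := 0) (v := v)) s
  simp only [mgf, id, zero_mul, zero_add] at h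
  rw [h]

/-- Tilting the centred Gaussian density by exp(w² / (4v)) doubles its variance, and the change of
normalization is √2. -/
lemma lintegral_exp_sq_gaussianReal {v : NNReal} (hv : v ≠ 0) :
    ∫⁻ w, ENNReal.ofReal (Real.exp (w ^ 2 / (4 * v))) ∂gaussianReal 0 v
      = ENNReal.ofReal (Real.sqrt 2) := by
  have hv' : (0 : ℝ) < v := by positivity
  rw [gaussianReal_of_var_ne_zero 0 hv, lintegral_withDensity_eq_lintegral_mul _
    (measurable_gaussianPDF 0 v) (by fun_prop)]
  have key : ∀ w : ℝ, (gaussianPDF 0 v * fun w : ℝ => ENNReal.ofReal (Real.exp (w ^ 2 / (4 * v)))) w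
      = ENNReal.ofReal (Real.sqrt 2) * gaussianPDF 0 (2 * v) w := by
    intro w
    simp only [Pi.mul_apply, gaussianPDF]
    rw [← ENNReal.ofReal_mul (gaussianPDFReal_nonneg _ _ _), ← ENNReal.ofReal_mul (by positivity)]
    congr 1
    simp only [gaussianPDFReal, sub_zero, NNReal.coe_mul, NNReal.coe_ofNat]
    rw [mul_assoc, ← Real.exp_add, ← mul_assoc]
    congr 1
    · rw [show 2 * Real.pi * (2 * (v : ℝ)) = 2 * (2 * Real.pi * v) by ring,
        Real.sqrt_mul (by norm_num : (0 : ℝ) ≤ 2)]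
      have : Real.sqrt 2 ≠ 0 := by positivity
      field_simp
    · congr 1
      field_simp
      ring
  simp_rw [key]
  rw [lintegral_const_mul _ (measurable_gaussianPDF _ _), lintegral_gaussianPDF_eq_one 0 (by simpa using hv),
    mul_one]

/-- Expectations of products over the observations factorize. -/
lemma IsGaussianRandomDesign.lintegral_prod_eq {Ω S : Type*} [MeasurableSpace Ω]
    [MeasurableSpace S] {n : ℕ} {P : Measure Ω} [IsProbabilityMeasure P] {μ : Measure S} {σ : ℝ}
    {X : Fin n → Ω → S} {W : Fin n → Ω → ℝ} (h : IsGaussianRandomDesign P μ σ X W)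
    {φ : S → ℝ → ENNReal} (hφ : Measurable (Function.uncurry φ)) :
    ∫⁻ ω, ∏ i, φ (X i ω) (W i ω) ∂P
      = ∏ _i : Fin n, ∫⁻ x, ∫⁻ w, φ x w ∂gaussianReal 0 (Real.toNNReal (σ ^ 2)) ∂μ := by
  have hX : Measurable fun ω i => X i ω := measurable_pi_lambda _ h.measurable_design
  have hW : Measurable fun ω i => W i ω := measurable_pi_lambda _ h.measurable_error
  have hF : Measurable fun p : (Fin n → S) × (Fin n → ℝ) => ∏ i, φ (p.1 i) (p.2 i) := by
    refine Finset.measurable_prod _ fun i _ => ?_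
    have hp : Measurable fun p : (Fin n → S) × (Fin n → ℝ) => (p.1 i, p.2 i) := by fun_prop
    exact hφ.comp hp
  -- Since design and errors are independent, the errors may be evaluated at an independent copy ω'.
  have e1 : ∫⁻ ω, ∏ i, φ (X i ω) (W i ω) ∂P
      = ∫⁻ ω, ∫⁻ ω', ∏ i, φ (X i ω) (W i ω') ∂P ∂P := by
    have hmap := (indepFun_iff_map_prod_eq_prod_map_map hX.aemeasurable hW.aemeasurable).1
      h.indep_design_error
    rw [← lintegral_map (f := fun p : (Fin n → S) × (Fin n → ℝ) => ∏ i, φ (p.1 i) (p.2 i))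
      (g := fun ω => ((fun i => X i ω), fun i => W i ω)) hF (hX.prodMk hW), hmap,
      lintegral_prod _ hF.aemeasurable, lintegral_map hF.lintegral_prod_right' hX]
    refine lintegral_congr fun ω => ?_
    exact lintegral_map (hF.comp measurable_prodMk_left) hW
  have hφx : ∀ x, Measurable (φ x) := fun x => hφ.comp measurable_prodMk_left
  have hψ : Measurable fun x => ∫⁻ w, φ x w ∂gaussianReal 0 (Real.toNNReal (σ ^ 2)) :=
    hφ.lintegral_prod_right'
  rw [e1]
  have e2 : ∀ ω, ∫⁻ ω', ∏ i, φ (X i ω) (W i ω') ∂P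
      = ∏ i, ∫⁻ w, φ (X i ω) w ∂gaussianReal 0 (Real.toNNReal (σ ^ 2)) := by
    intro ω
    rw [lintegral_prod_eq_prod_lintegral_of_indepFun Finset.univ
      (fun i ω' => φ (X i ω) (W i ω')) (h.indep_error.comp _ fun i => hφx (X i ω))
      fun i => (hφx _).comp (h.measurable_error i)]
    refine Finset.prod_congr rfl fun i _ => ?_
    rw [← h.law_error i, lintegral_map (hφx _) (h.measurable_error i)]
  simp_rw [e2]
  rw [lintegral_prod_eq_prod_lintegral_of_indepFun Finset.univ
    (fun i ω => ∫⁻ w, φ (X i ω) w ∂gaussianReal 0 (Real.toNNReal (σ ^ 2)))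
    (h.indep_design.comp _ fun i => hψ) fun i => hψ.comp (h.measurable_design i)]
  refine Finset.prod_congr rfl fun i _ => ?_
  rw [← lintegral_map hψ (h.measurable_design i), h.law_design i]

/-! ### Exponential moment of the deviation for a single function. -/

lemma integrable_sq_of_abs_le {S : Type*} [MeasurableSpace S] {μ : Measure S}
    [IsProbabilityMeasure μ] {g : S → ℝ} (hg : Measurable g) {b : ℝ} (hb : ∀ x, |g x| ≤ b) :
    Integrable (fun x => g x ^ 2) μ := by
  refine Integrable.of_bound (hg.pow_const 2).aestronglyMeasurable (b ^ 2) (ae_of_all _ fun x => ?_)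
  rw [Real.norm_eq_abs, abs_pow]
  exact pow_le_pow_left₀ (abs_nonneg _) (hb x) 2

lemma l2NormSq_nonneg {S : Type*} [MeasurableSpace S] (μ : Measure S) (g : S → ℝ) :
    0 ≤ l2NormSq μ g := integral_nonneg fun _ => sq_nonneg _

lemma l2NormSq_le {S : Type*} [MeasurableSpace S] {μ : Measure S}
    [IsProbabilityMeasure μ] {g : S → ℝ} (hg : Measurable g) {b : ℝ} (hb : ∀ x, |g x| ≤ b) :
    l2NormSq μ g ≤ b ^ 2 := by
  have : l2NormSq μ g ≤ ∫ _x : S, b ^ 2 ∂μ :=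
    integral_mono (integrable_sq_of_abs_le hg hb) (integrable_const _) fun x => by
      simpa using pow_le_pow_left₀ (abs_nonneg _) (hb x) 2
  simpa using this

/-- Follows from exp y ≥ 1 + y and (1 − y + y²)(1 + y) = 1 + y³. -/
lemma exp_neg_le_one_sub_add_sq {y : ℝ} (hy : 0 ≤ y) : Real.exp (-y) ≤ 1 - y + y ^ 2 := by
  rw [Real.exp_neg, inv_le_iff_one_le_mul₀ (Real.exp_pos y)]
  have h1 := Real.add_one_le_exp y
  have h2 : 0 ≤ 1 - y + y ^ 2 := by nlinarith [sq_nonneg (y - 1)]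
  nlinarith [mul_le_mul_of_nonneg_left h1 h2, pow_nonneg hy 3]

/-- One observation contributes at most `1` to the exponential moment of the contrast. -/
lemma lintegral_exp_contrast_le_one {S : Type*} [MeasurableSpace S] {μ : Measure S}
    [IsProbabilityMeasure μ] {g : S → ℝ} (hg : Measurable g) {b : ℝ} (hb : ∀ x, |g x| ≤ b)
    {v : NNReal} {ε t : ℝ} (hε : 0 < ε) (hε1 : ε ≤ 1) (ht : 0 ≤ t)
    (hts : t * (16 * (v + b ^ 2)) ≤ ε) :
    ∫⁻ x, ∫⁻ w, ENNReal.ofReal (Real.exp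
      (t * (l2NormSq μ g - (1 + ε) * (g x ^ 2 - 2 * w * g x)))) ∂gaussianReal 0 v ∂μ ≤ 1 := by
  set G := l2NormSq μ g with hG
  have hv : (0 : ℝ) ≤ v := v.2
  -- The surplus ε t g² is spent in two halves: one on the term 2 v t² (1+ε)² g² produced by the
  -- Gaussian integral, the other on the y² of the expansion of exp(−y).
  have hle : ∀ x, ∫⁻ w, ENNReal.ofReal (Real.exp
      (t * (G - (1 + ε) * (g x ^ 2 - 2 * w * g x)))) ∂gaussianReal 0 v
      ≤ ENNReal.ofReal (Real.exp (t * G) * (1 - t * g x ^ 2)) := by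
    intro x
    have e : ∀ w : ℝ, ENNReal.ofReal (Real.exp (t * (G - (1 + ε) * (g x ^ 2 - 2 * w * g x))))
        = ENNReal.ofReal (Real.exp (t * (G - (1 + ε) * g x ^ 2)))
          * ENNReal.ofReal (Real.exp ((2 * t * (1 + ε) * g x) * w)) := by
      intro w
      rw [← ENNReal.ofReal_mul (Real.exp_pos _).le, ← Real.exp_add]
      congr 2
      ring
    simp_rw [e]
    rw [lintegral_const_mul _ (by fun_prop), lintegral_exp_mul_gaussianReal,
      ← ENNReal.ofReal_mul (Real.exp_pos _).le, ← Real.exp_add]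
    refine ENNReal.ofReal_le_ofReal ?_
    have hu : 0 ≤ g x ^ 2 := sq_nonneg _
    have hub : g x ^ 2 ≤ b ^ 2 := by simpa using pow_le_pow_left₀ (abs_nonneg _) (hb x) 2
    set u := g x ^ 2 with hu_def
    have htv : 0 ≤ t * v := mul_nonneg ht hv
    have htb : 0 ≤ t * b ^ 2 := by positivity
    have htu : 0 ≤ t * u := mul_nonneg ht hu
    have htub : t * u ≤ t * b ^ 2 := mul_le_mul_of_nonneg_left hub ht
    set y := t * (1 + ε / 2) * u with hy
    have hy0 : 0 ≤ y := by positivity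
    have h4 : (1 + ε) ^ 2 ≤ 4 := by nlinarith
    have h5 : (1 + ε / 2) ^ 2 ≤ 4 := by nlinarith
    have hexp : t * (G - (1 + ε) * u) + v * (2 * t * (1 + ε) * g x) ^ 2 / 2 ≤ t * G + -y := by
      have : v * (2 * t * (1 + ε) * g x) ^ 2 / 2 = (t * u) * (2 * (t * v) * (1 + ε) ^ 2) := by
        rw [hu_def]; ring
      rw [this]
      have h6 : 2 * (t * v) * (1 + ε) ^ 2 ≤ ε / 2 := by nlinarith
      nlinarith [mul_le_mul_of_nonneg_left h6 htu]
    refine (Real.exp_le_exp.2 hexp).trans ?_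
    rw [Real.exp_add]
    refine mul_le_mul_of_nonneg_left ((exp_neg_le_one_sub_add_sq hy0).trans ?_) (Real.exp_pos _).le
    have h7 : y ^ 2 = (t * u) * ((t * u) * (1 + ε / 2) ^ 2) := by rw [hy]; ring
    have h8 : (t * u) * (1 + ε / 2) ^ 2 ≤ ε / 2 := by nlinarith
    nlinarith [mul_le_mul_of_nonneg_left h8 htu]
  refine (lintegral_mono hle).trans ?_
  have hint : Integrable (fun x => Real.exp (t * G) * (1 - t * g x ^ 2)) μ :=
    ((integrable_const 1).sub ((integrable_sq_of_abs_le hg hb).const_mul t)).const_mul _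
  have hnn : ∀ x, 0 ≤ Real.exp (t * G) * (1 - t * g x ^ 2) := by
    intro x
    refine mul_nonneg (Real.exp_pos _).le ?_
    have hub : g x ^ 2 ≤ b ^ 2 := by simpa using pow_le_pow_left₀ (abs_nonneg _) (hb x) 2
    nlinarith [mul_le_mul_of_nonneg_left hub ht, mul_nonneg ht hv, mul_nonneg ht (sq_nonneg b)]
  rw [← ofReal_integral_eq_lintegral_ofReal hint (ae_of_all _ hnn), integral_const_mul,
    integral_sub (integrable_const _) ((integrable_sq_of_abs_le hg hb).const_mul t),
    integral_const_mul]
  simp only [integral_const, probReal_univ, smul_eq_mul, mul_one]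
  rw [ENNReal.ofReal_le_one, show ∫ x, g x ^ 2 ∂μ = G from rfl]
  calc Real.exp (t * G) * (1 - t * G) ≤ Real.exp (t * G) * Real.exp (-(t * G)) :=
        mul_le_mul_of_nonneg_left (Real.one_sub_le_exp_neg _) (Real.exp_pos _).le
    _ = 1 := by rw [← Real.exp_add]; simp

/-- The deviation of the `L²` norm of `g` from `1 + ε` times its empirical contrast. -/
noncomputable def deviation {S : Type*} [MeasurableSpace S] {n : ℕ} (μ : Measure S) (ε : ℝ)
    (g : S → ℝ) (x : Fin n → S) (w : Fin n → ℝ) : ℝ :=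
  l2NormSq μ g - (1 + ε) * ((1 / (n : ℝ)) * ∑ i, (g (x i) ^ 2 - 2 * w i * g (x i)))

lemma lintegral_exp_deviation_le_one {Ω S : Type*} [MeasurableSpace Ω]
    [MeasurableSpace S] {n : ℕ} (hn : 1 ≤ n) {P : Measure Ω} [IsProbabilityMeasure P]
    {μ : Measure S} [IsProbabilityMeasure μ] {σ : ℝ}
    {X : Fin n → Ω → S} {W : Fin n → Ω → ℝ} (h : IsGaussianRandomDesign P μ σ X W)
    {g : S → ℝ} (hg : Measurable g) {b : ℝ} (hb : ∀ x, |g x| ≤ b)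
    {ε t : ℝ} (hε : 0 < ε) (hε1 : ε ≤ 1) (ht : 0 ≤ t)
    (hts : t * (16 * (σ ^ 2 + b ^ 2)) ≤ ε) :
    ∫⁻ ω, ENNReal.ofReal (Real.exp (n * t * deviation μ ε g (fun i => X i ω) (fun i => W i ω))) ∂P
      ≤ 1 := by
  have hn' : (n : ℝ) ≠ 0 := by positivity
  have e : ∀ ω, ENNReal.ofReal (Real.exp
      (n * t * deviation μ ε g (fun i => X i ω) (fun i => W i ω)))
      = ∏ i, ENNReal.ofReal (Real.exp
          (t * (l2NormSq μ g - (1 + ε) * (g (X i ω) ^ 2 - 2 * W i ω * g (X i ω))))) := by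
    intro ω
    rw [← ENNReal.ofReal_prod_of_nonneg fun i _ => (Real.exp_pos _).le, ← Real.exp_sum]
    congr 2
    simp only [← Finset.mul_sum, Finset.sum_sub_distrib, Finset.sum_const, Finset.card_univ,
      Fintype.card_fin, nsmul_eq_mul, deviation]
    field_simp
  simp_rw [e]
  rw [h.lintegral_prod_eq (φ := fun x w => ENNReal.ofReal (Real.exp
    (t * (l2NormSq μ g - (1 + ε) * (g x ^ 2 - 2 * w * g x)))))
    (by simp only [Function.uncurry_def]; fun_prop)]
  refine Finset.prod_le_one' fun i _ => lintegral_exp_contrast_le_one hg hb hε hε1 ht ?_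
  rwa [Real.coe_toNNReal _ (sq_nonneg _)]

/-! ### From exponential moments to expected positive parts. -/

lemma max_zero_le_exp_div {s : ℝ} (hs : 0 < s) (x : ℝ) : max x 0 ≤ Real.exp (s * x) / s := by
  rw [le_div_iff₀ hs]
  rcases le_total x 0 with hx | hx
  · rw [max_eq_right hx, zero_mul]; positivity
  · rw [max_eq_left hx]; linarith [Real.add_one_le_exp (s * x), mul_comm s x]

lemma integrable_and_integral_le_of_lintegral {Ω : Type*} [MeasurableSpace Ω] {P : Measure Ω}
    {F : Ω → ℝ} (hF : Measurable F) (h0 : ∀ ω, 0 ≤ F ω) {C : ℝ} (hC : 0 ≤ C)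
    (h : ∫⁻ ω, ENNReal.ofReal (F ω) ∂P ≤ ENNReal.ofReal C) :
    Integrable F P ∧ ∫ ω, F ω ∂P ≤ C := by
  constructor
  · refine ⟨hF.aestronglyMeasurable, ?_⟩
    rw [hasFiniteIntegral_iff_ofReal (ae_of_all _ h0)]
    exact h.trans_lt ENNReal.ofReal_lt_top
  · rw [integral_eq_lintegral_of_nonneg_ae (ae_of_all _ h0) hF.aestronglyMeasurable]
    exact ENNReal.toReal_le_of_le_ofReal hC h

/-- The mean square of the errors. -/
noncomputable def meanSq {n : ℕ} (w : Fin n → ℝ) : ℝ := (1 / (n : ℝ)) * ∑ i, w i ^ 2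

/-- With s = n / (4σ²), exp(s · `meanSq`) is a product of n independent factors of mean √2. The
threshold 2σ² contributes exp(−n/2), which beats √2ⁿ, leaving 1 / s. -/
lemma integral_meanSq_excess_le {Ω S : Type*} [MeasurableSpace Ω]
    [MeasurableSpace S] {n : ℕ} (hn : 1 ≤ n) {P : Measure Ω} [IsProbabilityMeasure P]
    {μ : Measure S} [IsProbabilityMeasure μ] {σ : ℝ} (hσ : 0 < σ)
    {X : Fin n → Ω → S} {W : Fin n → Ω → ℝ} (h : IsGaussianRandomDesign P μ σ X W) :
    Integrable (fun ω => max (meanSq (fun i => W i ω) - 2 * σ ^ 2) 0) P ∧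
      ∫ ω, max (meanSq (fun i => W i ω) - 2 * σ ^ 2) 0 ∂P ≤ 4 * σ ^ 2 / n := by
  have hn' : (0 : ℝ) < n := by exact_mod_cast hn
  have hW := h.measurable_error
  set s : ℝ := n / (4 * σ ^ 2) with hs
  have hs0 : 0 < s := by positivity
  refine integrable_and_integral_le_of_lintegral (by unfold meanSq; fun_prop)
    (fun ω => le_max_right _ _) (by positivity) ?_
  have hle : ∀ ω, ENNReal.ofReal (max (meanSq (fun i => W i ω) - 2 * σ ^ 2) 0)
      ≤ ENNReal.ofReal (Real.exp (-(n / 2)) / s)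
        * ∏ i, ENNReal.ofReal (Real.exp ((W i ω) ^ 2 / (4 * (Real.toNNReal (σ ^ 2) : ℝ)))) := by
    intro ω
    rw [← ENNReal.ofReal_prod_of_nonneg fun i _ => (Real.exp_pos _).le, ← Real.exp_sum,
      ← ENNReal.ofReal_mul (by positivity)]
    refine ENNReal.ofReal_le_ofReal ((max_zero_le_exp_div hs0 _).trans_eq ?_)
    rw [div_mul_eq_mul_div (Real.exp (-(n / 2 : ℝ))), ← Real.exp_add]
    congr 2
    rw [Real.coe_toNNReal _ (sq_nonneg _), ← Finset.sum_div, meanSq, hs]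
    field_simp
    ring
  refine (lintegral_mono hle).trans ?_
  rw [lintegral_const_mul _ (by fun_prop), h.lintegral_prod_eq
    (φ := fun _ w => ENNReal.ofReal (Real.exp (w ^ 2 / (4 * (Real.toNNReal (σ ^ 2) : ℝ)))))
    (by simp only [Function.uncurry_def]; fun_prop)]
  simp only [lintegral_exp_sq_gaussianReal (v := Real.toNNReal (σ ^ 2))
    (by simpa using hσ.ne'), lintegral_const, measure_univ, mul_one, Finset.prod_const,
    Finset.card_univ, Fintype.card_fin]
  rw [← ENNReal.ofReal_pow (by positivity), ← ENNReal.ofReal_mul (by positivity)]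
  refine ENNReal.ofReal_le_ofReal ?_
  have h2 : Real.sqrt 2 ≤ Real.exp (1 / 2) := by
    rw [Real.sqrt_le_left (Real.exp_pos _).le, ← Real.exp_nat_mul]
    have := Real.add_one_le_exp 1
    norm_num at this ⊢
    linarith
  have h3 : Real.sqrt 2 ^ n ≤ Real.exp (n / 2) := by
    refine (pow_le_pow_left₀ (by positivity) h2 n).trans_eq ?_
    rw [← Real.exp_nat_mul]; congr 1; ring
  calc Real.exp (-(n / 2)) / s * Real.sqrt 2 ^ n
      ≤ Real.exp (-(n / 2)) / s * Real.exp (n / 2) := by gcongr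
    _ = 4 * σ ^ 2 / n := by
      rw [div_mul_eq_mul_div, ← Real.exp_add, hs]
      simp

/-! ### Complexity and the weighted count of grid points. -/

/-- The complexity `k log (1 + m / (k ∨ 1))` of a model of dimension `k`. -/
noncomputable def complexity (m : ℝ) (k : ℕ) : ℝ := k * Real.log (1 + m / max (k : ℝ) 1)

lemma complexity_zero (m : ℝ) : complexity m 0 = 0 := by simp [complexity]

lemma complexity_of_pos (m : ℝ) {k : ℕ} (hk : 1 ≤ k) :
    complexity m k = k * Real.log (1 + m / k) := by
  have : (1 : ℝ) ≤ k := by exact_mod_cast hk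
  rw [complexity, max_eq_left this]

lemma complexity_nonneg {m : ℝ} (hm : 0 ≤ m) (k : ℕ) : 0 ≤ complexity m k := by
  refine mul_nonneg (Nat.cast_nonneg k) (Real.log_nonneg ?_)
  have : 0 ≤ m / max (k : ℝ) 1 := by positivity
  linarith

/-- Bernoulli's inequality: (1 + m/k)^(k/s) ≥ 1 + m/s for s ≤ k. -/
lemma complexity_mono {m : ℝ} (hm : 0 ≤ m) : Monotone (complexity m) := by
  intro s k hsk
  rcases Nat.eq_zero_or_pos s with rfl | hs
  · rw [complexity_zero]; exact complexity_nonneg hm k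
  have hs' : (0 : ℝ) < s := by exact_mod_cast hs
  have hk' : (0 : ℝ) < k := by exact_mod_cast hs.trans_le hsk
  have hsk' : (s : ℝ) ≤ k := by exact_mod_cast hsk
  rw [complexity_of_pos m hs, complexity_of_pos m (hs.trans_le hsk)]
  have hmk : 0 ≤ m / k := by positivity
  have hB := one_add_mul_self_le_rpow_one_add (s := m / k) (by linarith) (p := k / s)
    ((one_le_div hs').2 hsk')
  have e : (k : ℝ) / s * (m / k) = m / s := by field_simp
  rw [e] at hB
  have hlog := Real.log_le_log (by positivity) hB
  rw [Real.log_rpow (by positivity)] at hlog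
  calc (s : ℝ) * Real.log (1 + m / s) ≤ s * (k / s * Real.log (1 + m / k)) := by gcongr
    _ = k * Real.log (1 + m / k) := by field_simp

lemma mul_log_two_le_complexity {m : ℝ} {k : ℕ} (hk : (k : ℝ) ≤ m) :
    k * Real.log 2 ≤ complexity m k := by
  rcases Nat.eq_zero_or_pos k with rfl | hs
  · simp [complexity]
  have hk' : (0 : ℝ) < k := by exact_mod_cast hs
  rw [complexity_of_pos m hs]
  have : 1 ≤ m / k := (one_le_div hk').2 hk
  have := Real.log_le_log two_pos (show (2 : ℝ) ≤ 1 + m / k by linarith)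
  gcongr

/-- The integer points of the `ℓ¹`-ball of radius `n`. -/
noncomputable def intL1Ball (n M : ℕ) : Finset (Fin M → ℤ) :=
  (Fintype.piFinset fun _ => Finset.Icc (-(n : ℤ)) n).filter fun a => ∑ j, |a j| ≤ n

lemma mem_intL1Ball {n M : ℕ} {a : Fin M → ℤ} : a ∈ intL1Ball n M ↔ ∑ j, |a j| ≤ n := by
  simp only [intL1Ball, Finset.mem_filter, Fintype.mem_piFinset, Finset.mem_Icc,
    and_iff_right_iff_imp]
  intro h j
  have := (Finset.single_le_sum (f := fun j => |a j|) (fun i _ => abs_nonneg (a i))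
    (Finset.mem_univ j)).trans h
  exact abs_le.1 this

/-- The number of non-zero coordinates of an integer vector. -/
def intSupport {M : ℕ} (a : Fin M → ℤ) : ℕ := (Finset.univ.filter fun j => a j ≠ 0).card

lemma intSupport_le {M : ℕ} (a : Fin M → ℤ) : intSupport a ≤ M :=
  (Finset.card_filter_le _ _).trans_eq (by simp)

lemma sum_Icc_exp_le {θ y : ℝ} (hθ : 0 < θ) (hy : 0 ≤ y) (n : ℕ) :
    ∑ r ∈ Finset.Icc (-(n : ℤ)) n, Real.exp (-θ * |(r : ℝ)|) * (if r ≠ 0 then y else 1)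
      ≤ 1 + 2 * y / θ := by
  -- The bound is strengthened by a geometric factor so that induction closes: the new pair ±(n+1)
  -- is paid for by θ exp(−θ) ≤ 1 − exp(−θ).
  suffices h : ∑ r ∈ Finset.Icc (-(n : ℤ)) n,
      Real.exp (-θ * |(r : ℝ)|) * (if r ≠ 0 then y else 1)
      ≤ 1 + 2 * y / θ * (1 - Real.exp (-θ) ^ n) by
    refine h.trans ?_
    have : 0 ≤ 2 * y / θ := by positivity
    have : 0 ≤ Real.exp (-θ) ^ n := by positivity
    nlinarith
  induction n with
  | zero => simp
  | succ n ih =>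
    have e : Finset.Icc (-((n + 1 : ℕ) : ℤ)) ((n + 1 : ℕ) : ℤ)
        = insert (-((n : ℤ) + 1)) (insert ((n : ℤ) + 1) (Finset.Icc (-(n : ℤ)) n)) := by
      ext r
      simp only [Finset.mem_Icc, Finset.mem_insert]
      push_cast
      omega
    rw [e, Finset.sum_insert (by simp only [Finset.mem_insert, Finset.mem_Icc]; omega),
      Finset.sum_insert (by simp)]
    have h1 : ((n : ℤ) + 1) ≠ 0 := by omega
    have h2 : (-((n : ℤ) + 1)) ≠ 0 := by omega
    rw [if_pos h1, if_pos h2]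
    push_cast
    rw [abs_neg, abs_of_nonneg (by positivity : (0 : ℝ) ≤ n + 1)]
    have e2 : Real.exp (-θ * ((n : ℝ) + 1)) = Real.exp (-θ) ^ n * Real.exp (-θ) := by
      rw [← Real.exp_nat_mul, ← Real.exp_add]; congr 1; ring
    have h3 : θ * Real.exp (-θ) ≤ 1 - Real.exp (-θ) := by
      have h4 := mul_le_mul_of_nonneg_right (Real.add_one_le_exp θ) (Real.exp_pos (-θ)).le
      rw [← Real.exp_add] at h4
      simp at h4
      linarith
    have h5 : Real.exp (-θ) ≤ (1 - Real.exp (-θ)) / θ := by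
      rw [le_div_iff₀ hθ]; linarith
    rw [e2, pow_succ]
    have h6 : 0 ≤ 2 * y * Real.exp (-θ) ^ n := by positivity
    have h7 := mul_le_mul_of_nonneg_left h5 h6
    have h8 : 2 * y / θ * (1 - Real.exp (-θ) ^ n * Real.exp (-θ))
        = 2 * y / θ * (1 - Real.exp (-θ) ^ n)
          + 2 * y * Real.exp (-θ) ^ n * ((1 - Real.exp (-θ)) / θ) := by
      field_simp
      ring
    rw [h8]
    linarith

/-- A Chernoff bound for the number of integer points with `s` non-zero coordinates. -/
lemma card_intSupport_eq_le {n M s : ℕ} (hn : 1 ≤ n) (hM : 1 ≤ M) (hs : 1 ≤ s) :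
    (((intL1Ball n M).filter fun a => intSupport a = s).card : ℝ)
      ≤ (2 * Real.exp 2 * (n * M) / (s : ℝ) ^ 2) ^ s := by
  have hn' : (0 : ℝ) < n := by exact_mod_cast hn
  have hM' : (0 : ℝ) < M := by exact_mod_cast hM
  have hs' : (0 : ℝ) < s := by exact_mod_cast hs
  -- Each counted point has weight `F` at least exp(−s) yˢ, as its ℓ¹-norm is at most n. The total
  -- weight is at most (1 + 2y/θ)^M, and y is chosen to make this (1 + s/M)^M ≤ exp(s).
  set θ : ℝ := s / n with hθ
  have hθ0 : 0 < θ := by positivity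
  set y : ℝ := θ * s / (2 * M) with hy
  have hy0 : 0 < y := by positivity
  set F : (Fin M → ℤ) → ℝ := fun a =>
    ∏ j, (Real.exp (-θ * |(a j : ℝ)|) * (if a j ≠ 0 then y else 1)) with hF
  have hF0 : ∀ a, 0 ≤ F a := fun a => Finset.prod_nonneg fun j _ => by positivity
  have h1 : ∀ a ∈ (intL1Ball n M).filter fun a => intSupport a = s,
      (1 : ℝ) ≤ Real.exp s * (y ^ s)⁻¹ * F a := by
    intro a ha
    obtain ⟨ha1, ha2⟩ := Finset.mem_filter.1 ha
    rw [mem_intL1Ball] at ha1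
    have e : F a = Real.exp (-θ * ∑ j, |(a j : ℝ)|) * y ^ s := by
      simp only [hF]
      rw [Finset.prod_mul_distrib, ← Real.exp_sum, Finset.prod_ite, Finset.prod_const,
        Finset.prod_const_one, mul_one, ← ha2, intSupport, Finset.mul_sum]
    have hsum : (∑ j, |(a j : ℝ)|) ≤ n := by exact_mod_cast ha1
    have : Real.exp s * (y ^ s)⁻¹ * F a = Real.exp (s + -θ * ∑ j, |(a j : ℝ)|) := by
      rw [e, Real.exp_add]
      field_simp
    rw [this, Real.one_le_exp_iff]
    have : θ * ∑ j, |(a j : ℝ)| ≤ θ * n := by gcongr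
    have e3 : θ * n = s := by rw [hθ]; field_simp
    linarith
  have h2 : ∑ a ∈ (intL1Ball n M).filter (fun a => intSupport a = s), F a ≤ Real.exp s := by
    calc ∑ a ∈ (intL1Ball n M).filter (fun a => intSupport a = s), F a
        ≤ ∑ a ∈ Fintype.piFinset fun _ : Fin M => Finset.Icc (-(n : ℤ)) n, F a :=
          Finset.sum_le_sum_of_subset_of_nonneg
            ((Finset.filter_subset _ _).trans (Finset.filter_subset _ _)) fun a _ _ => hF0 a
      _ = ∏ _j : Fin M, ∑ r ∈ Finset.Icc (-(n : ℤ)) n,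
            Real.exp (-θ * |(r : ℝ)|) * (if r ≠ 0 then y else 1) :=
          (Finset.prod_univ_sum (fun _ : Fin M => Finset.Icc (-(n : ℤ)) n)
            fun _ (r : ℤ) => Real.exp (-θ * |(r : ℝ)|) * (if r ≠ 0 then y else 1)).symm
      _ ≤ ∏ _j : Fin M, Real.exp (s / M) := by
          refine Finset.prod_le_prod (fun _ _ => Finset.sum_nonneg fun r _ => by positivity)
            fun _ _ => (sum_Icc_exp_le hθ0 hy0.le n).trans ?_
          have e : 2 * y / θ = s / M := by rw [hy]; field_simp
          rw [e, add_comm]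
          exact Real.add_one_le_exp _
      _ = Real.exp s := by
          rw [Finset.prod_const, ← Real.exp_nat_mul]
          congr 1
          simp only [Finset.card_univ, Fintype.card_fin]
          field_simp
  calc (((intL1Ball n M).filter fun a => intSupport a = s).card : ℝ)
      = ∑ a ∈ (intL1Ball n M).filter (fun a => intSupport a = s), (1 : ℝ) := by simp
    _ ≤ ∑ a ∈ (intL1Ball n M).filter (fun a => intSupport a = s),
          Real.exp s * (y ^ s)⁻¹ * F a := Finset.sum_le_sum h1
    _ ≤ Real.exp s * (y ^ s)⁻¹ * Real.exp s := by
        rw [← Finset.mul_sum]; gcongr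
    _ = (2 * Real.exp 2 * (n * M) / (s : ℝ) ^ 2) ^ s := by
        have e1 : Real.exp (s : ℝ) = Real.exp 1 ^ s := by rw [← Real.exp_nat_mul]; simp
        have e2 : Real.exp 2 = Real.exp 1 * Real.exp 1 := by rw [← Real.exp_add]; norm_num
        rw [e1, ← inv_pow, ← mul_pow, ← mul_pow, e2, hy, hθ]
        congr 1
        field_simp

lemma intSupport_eq_zero {M : ℕ} {a : Fin M → ℤ} (h : intSupport a = 0) : a = 0 := by
  ext j
  by_contra hj
  exact (Finset.card_pos.2 ⟨j, by simpa using hj⟩).ne' h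

/-- With u = 1 + m/s ≥ 2, level s has at most (16u²)ˢ points. Since 16 ≤ u⁵/2, the factor u⁻⁷ leaves
(1/2)ˢ, and the geometric series sums to at most 2. -/
lemma sum_exp_neg_complexity_le_two {n M : ℕ} (hn : 1 ≤ n) (hM : 1 ≤ M) :
    ∑ a ∈ intL1Ball n M, Real.exp (-(7 * complexity (max (M : ℝ) n) (intSupport a))) ≤ 2 := by
  set m : ℝ := max (M : ℝ) n with hm
  have hn' : (0 : ℝ) < n := by exact_mod_cast hn
  have hM' : (0 : ℝ) < M := by exact_mod_cast hM
  have hMm : (M : ℝ) ≤ m := le_max_left _ _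
  have hnm : (n : ℝ) ≤ m := le_max_right _ _
  have hm0 : 0 < m := hM'.trans_le hMm
  rw [← Finset.sum_fiberwise_of_maps_to (t := Finset.range (M + 1)) (g := intSupport)
    (fun a _ => Finset.mem_range.2 (Nat.lt_succ_of_le (intSupport_le a)))]
  have key : ∀ s ∈ Finset.range (M + 1),
      ∑ a ∈ (intL1Ball n M).filter (fun a => intSupport a = s),
        Real.exp (-(7 * complexity m (intSupport a))) ≤ (1 / 2 : ℝ) ^ s := by
    intro s hs
    have e : ∑ a ∈ (intL1Ball n M).filter (fun a => intSupport a = s),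
        Real.exp (-(7 * complexity m (intSupport a)))
        = ((intL1Ball n M).filter fun a => intSupport a = s).card
          * Real.exp (-(7 * complexity m s)) := by
      rw [Finset.sum_congr rfl fun a ha => by rw [(Finset.mem_filter.1 ha).2],
        Finset.sum_const, nsmul_eq_mul]
    rw [e]
    rcases Nat.eq_zero_or_pos s with rfl | hs0
    · have : ((intL1Ball n M).filter fun a => intSupport a = 0).card ≤ 1 :=
        Finset.card_le_one.2 fun a ha b hb => by
          rw [intSupport_eq_zero (Finset.mem_filter.1 ha).2,
            intSupport_eq_zero (Finset.mem_filter.1 hb).2]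
      simp only [complexity_zero, mul_zero, neg_zero, Real.exp_zero, mul_one, pow_zero]
      exact_mod_cast this
    have hs' : (0 : ℝ) < s := by exact_mod_cast hs0
    have hsM : (s : ℝ) ≤ M := by exact_mod_cast Nat.lt_succ_iff.1 (Finset.mem_range.1 hs)
    set u : ℝ := 1 + m / s with hu
    have hms : 1 ≤ m / s := (one_le_div hs').2 (hsM.trans hMm)
    have hu2 : 2 ≤ u := by linarith
    have hu0 : 0 < u := by linarith
    have e1 : Real.exp (-(7 * complexity m s)) = ((u ^ 7)⁻¹) ^ s := by
      rw [complexity_of_pos m hs0, ← hu, show -(7 * (s * Real.log u)) = s * -(7 * Real.log u) by ring,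
        Real.exp_nat_mul, Real.exp_neg]
      congr 2
      rw [show 7 * Real.log u = (7 : ℕ) * Real.log u by norm_num, Real.exp_nat_mul, Real.exp_log hu0]
    rw [e1]
    refine (mul_le_mul_of_nonneg_right (card_intSupport_eq_le hn hM hs0) (by positivity)).trans ?_
    rw [← mul_pow]
    refine pow_le_pow_left₀ (by positivity) ?_ s
    rw [← div_eq_mul_inv, div_le_iff₀ (by positivity)]
    have he : Real.exp 2 ≤ 8 := by
      have e2 : Real.exp 2 = Real.exp 1 * Real.exp 1 := by rw [← Real.exp_add]; norm_num
      rw [e2]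
      nlinarith [Real.exp_one_lt_d9, Real.exp_pos 1]
    have hnM : (n : ℝ) * M ≤ m ^ 2 := by
      rw [sq]; exact mul_le_mul hnm hMm hM'.le hm0.le
    calc 2 * Real.exp 2 * (n * M) / (s : ℝ) ^ 2 ≤ 2 * 8 * m ^ 2 / (s : ℝ) ^ 2 := by gcongr
      _ = 16 * (m / s) ^ 2 := by rw [div_pow]; ring
      _ ≤ 16 * u ^ 2 := by gcongr; linarith
      _ ≤ (1 / 2 * u ^ 5) * u ^ 2 := by
          gcongr
          have := pow_le_pow_left₀ (by norm_num) hu2 5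
          linarith
      _ = 1 / 2 * u ^ 7 := by ring
  refine (Finset.sum_le_sum key).trans ?_
  rw [geom_sum_eq (by norm_num)]
  have : (0 : ℝ) ≤ (1 / 2) ^ (M + 1) := by positivity
  rw [div_le_iff_of_neg (by norm_num)]
  linarith

/-! ### Rounding to the grid. -/

/-- Rounding is towards zero: the second bound keeps rounded vectors in the ball and sends 0 to 0,
so supports do not grow. -/
lemma exists_int_abs_sub_le_one (r : ℝ) : ∃ z : ℤ, |r - z| ≤ 1 ∧ |(z : ℝ)| ≤ |r| := by
  rcases le_total 0 r with hr | hr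
  · refine ⟨⌊r⌋, ?_, ?_⟩
    · rw [abs_le]; constructor <;> linarith [Int.floor_le r, Int.lt_floor_add_one r]
    · have : (0 : ℝ) ≤ ⌊r⌋ := by exact_mod_cast Int.floor_nonneg.2 hr
      rw [abs_of_nonneg this, abs_of_nonneg hr]
      exact Int.floor_le r
  · refine ⟨⌈r⌉, ?_, ?_⟩
    · rw [abs_le]; constructor <;> linarith [Int.le_ceil r, Int.ceil_lt_add_one r]
    · have : (⌈r⌉ : ℝ) ≤ 0 := by exact_mod_cast Int.ceil_le.2 (by simpa using hr)
      rw [abs_of_nonpos this, abs_of_nonpos hr]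
      linarith [Int.le_ceil r]

/-- The point of the `ℓ¹`-ball of radius `T` given by an integer point of the ball of radius `n`. -/
noncomputable def gridPoint {M : ℕ} (T : ℝ) (n : ℕ) (a : Fin M → ℤ) (j : Fin M) : ℝ :=
  T * a j / n

lemma gridPoint_mem {n M : ℕ} (hn : 1 ≤ n) {T : ℝ} (hT : 0 ≤ T) {a : Fin M → ℤ}
    (ha : a ∈ intL1Ball n M) : gridPoint T n a ∈ l1Ball M T := by
  have hn' : (0 : ℝ) < n := by exact_mod_cast hn
  rw [mem_intL1Ball] at ha
  have ha' : (∑ j, |(a j : ℝ)|) ≤ n := by exact_mod_cast ha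
  have e : ∀ j, |gridPoint T n a j| = T / n * |(a j : ℝ)| := by
    intro j
    rw [gridPoint, abs_div, abs_mul, abs_of_nonneg hT, abs_of_pos hn']
    ring
  simp only [l1Ball, Set.mem_ofPred_eq, e, ← Finset.mul_sum]
  calc T / n * ∑ j, |(a j : ℝ)| ≤ T / n * n := by gcongr
    _ = T := by field_simp

/-- Truncation to the grid moves each non-zero coordinate by at most `T / n`. -/
lemma exists_gridPoint {n M : ℕ} (hn : 1 ≤ n) {T : ℝ} (hT : 0 < T) {lam : Fin M → ℝ}
    (hlam : lam ∈ l1Ball M T) :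
    ∃ a ∈ intL1Ball n M, intSupport a ≤ numNonzero lam ∧
      ∑ j, |lam j - gridPoint T n a j| ≤ numNonzero lam * (T / n) := by
  have hn' : (0 : ℝ) < n := by exact_mod_cast hn
  choose z hz1 hz2 using exists_int_abs_sub_le_one
  have habs : ∀ j, |lam j * n / T| = |lam j| * (n / T) := by
    intro j
    rw [abs_div, abs_mul, abs_of_pos hT, abs_of_pos hn']; ring
  have hzero : ∀ j, lam j = 0 → z (lam j * n / T) = 0 := by
    intro j hj
    have : |(z (lam j * n / T) : ℝ)| ≤ 0 := (hz2 _).trans_eq (by rw [habs, hj]; simp)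
    exact_mod_cast abs_nonpos_iff.1 this
  refine ⟨fun j => z (lam j * n / T), ?_, ?_, ?_⟩
  · rw [mem_intL1Ball]
    have : ∑ j, |(z (lam j * n / T) : ℝ)| ≤ n := by
      refine (Finset.sum_le_sum fun j _ => hz2 _).trans ?_
      simp only [habs, ← Finset.sum_mul]
      calc (∑ j, |lam j|) * (n / T) ≤ T * (n / T) := by gcongr; exact hlam
        _ = n := by field_simp
    exact_mod_cast this
  · refine Finset.card_le_card fun j hj => ?_
    simp only [Finset.mem_filter, Finset.mem_univ, true_and] at hj ⊢
    exact fun h => hj (hzero j h)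
  · have hj : ∀ j, |lam j - gridPoint T n (fun j => z (lam j * n / T)) j|
        ≤ if lam j ≠ 0 then T / n else 0 := by
      intro j
      split_ifs with h
      · have e : lam j - gridPoint T n (fun j => z (lam j * n / T)) j
            = T / n * (lam j * n / T - z (lam j * n / T)) := by
          rw [gridPoint]; field_simp
        rw [e, abs_mul, abs_of_pos (by positivity)]
        exact mul_le_of_le_one_right (by positivity) (hz1 _)
      · push Not at h
        rw [gridPoint, hzero j h, h]
        simp
    refine (Finset.sum_le_sum fun j _ => hj j).trans_eq ?_
    rw [← Finset.sum_filter, Finset.sum_const, nsmul_eq_mul, numNonzero]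

/-! ### Pathwise bounds on the deviation. -/

section Deterministic

variable {S : Type*} [MeasurableSpace S] {μ : Measure S} [IsProbabilityMeasure μ] {n : ℕ}

/-- The norm moves by at most 2b²κ. The contrast moves by at most κ(3b² + `meanSq w`), using 2b|w| ≤
b² + w² for the cross term, and is multiplied by 1 + ε ≤ 2. -/
lemma deviation_le_of_abs_sub_le (hn : 1 ≤ n) {g h : S → ℝ} (hg : Measurable g)
    (hh : Measurable h) {b κ : ℝ} (hb : 0 ≤ b) (hκ : 0 ≤ κ) (hgb : ∀ x, |g x| ≤ b)
    (hhb : ∀ x, |h x| ≤ b) (hgh : ∀ x, |g x - h x| ≤ b * κ) {ε : ℝ} (hε : 0 < ε) (hε1 : ε ≤ 1)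
    (x : Fin n → S) (w : Fin n → ℝ) :
    deviation μ ε g x w ≤ deviation μ ε h x w + κ * (8 * b ^ 2 + 2 * meanSq w) := by
  have hn' : (0 : ℝ) < n := by exact_mod_cast hn
  have hsq : ∀ x, |g x ^ 2 - h x ^ 2| ≤ 2 * b ^ 2 * κ := by
    intro x
    rw [show g x ^ 2 - h x ^ 2 = (g x - h x) * (g x + h x) by ring, abs_mul]
    calc |g x - h x| * |g x + h x| ≤ (b * κ) * (b + b) :=
          mul_le_mul (hgh x) ((abs_add_le _ _).trans (add_le_add (hgb x) (hhb x)))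
            (abs_nonneg _) (by positivity)
      _ = 2 * b ^ 2 * κ := by ring
  have h1 : l2NormSq μ g - l2NormSq μ h ≤ 2 * b ^ 2 * κ := by
    rw [l2NormSq, l2NormSq, ← integral_sub (integrable_sq_of_abs_le hg hgb)
      (integrable_sq_of_abs_le hh hhb)]
    have := integral_mono ((integrable_sq_of_abs_le hg hgb).sub (integrable_sq_of_abs_le hh hhb))
      (integrable_const (μ := μ) (2 * b ^ 2 * κ)) fun x => (abs_le.1 (hsq x)).2
    simpa using this
  have h2 : ∀ i, (h (x i) ^ 2 - 2 * w i * h (x i)) - (g (x i) ^ 2 - 2 * w i * g (x i))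
      ≤ κ * (3 * b ^ 2 + w i ^ 2) := by
    intro i
    have h3 : 2 * w i * (g (x i) - h (x i)) ≤ κ * (b ^ 2 + w i ^ 2) := by
      calc 2 * w i * (g (x i) - h (x i)) ≤ |2 * w i * (g (x i) - h (x i))| := le_abs_self _
        _ = 2 * |w i| * |g (x i) - h (x i)| := by rw [abs_mul, abs_mul, abs_two]
        _ ≤ 2 * |w i| * (b * κ) := by gcongr; exact hgh _
        _ = κ * (2 * b * |w i|) := by ring
        _ ≤ κ * (b ^ 2 + |w i| ^ 2) := by gcongr; exact two_mul_le_add_sq _ _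
        _ = κ * (b ^ 2 + w i ^ 2) := by rw [sq_abs]
    have := (abs_le.1 (hsq (x i))).1
    linarith
  have h4 : (1 / (n : ℝ)) * ∑ i, (h (x i) ^ 2 - 2 * w i * h (x i))
      - (1 / (n : ℝ)) * ∑ i, (g (x i) ^ 2 - 2 * w i * g (x i))
      ≤ κ * (3 * b ^ 2 + meanSq w) := by
    rw [← mul_sub, ← Finset.sum_sub_distrib]
    calc (1 / (n : ℝ)) * ∑ i, ((h (x i) ^ 2 - 2 * w i * h (x i))
          - (g (x i) ^ 2 - 2 * w i * g (x i)))
        ≤ (1 / (n : ℝ)) * ∑ i, κ * (3 * b ^ 2 + w i ^ 2) := by gcongr with i; exact h2 i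
      _ = κ * (3 * b ^ 2 + meanSq w) := by
        rw [← Finset.mul_sum, Finset.sum_add_distrib, meanSq]
        simp only [Finset.sum_const, Finset.card_univ, Fintype.card_fin, nsmul_eq_mul]
        field_simp
  have hV : 0 ≤ meanSq w := by unfold meanSq; positivity
  have h5 : 0 ≤ κ * (3 * b ^ 2 + meanSq w) := by positivity
  have h6 := mul_le_mul_of_nonneg_left h4 (by linarith : 0 ≤ 1 + ε)
  have h7 : (1 + ε) * (κ * (3 * b ^ 2 + meanSq w)) ≤ 2 * (κ * (3 * b ^ 2 + meanSq w)) := by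
    gcongr; linarith
  simp only [deviation]
  linarith

/-- Completing the square gives g² − 2wg ≥ −w². This crude bound serves models with more than n
coefficients. -/
lemma deviation_le (hn : 1 ≤ n) {g : S → ℝ} (hg : Measurable g) {b : ℝ}
    (hgb : ∀ x, |g x| ≤ b) {ε : ℝ} (hε : 0 < ε) (hε1 : ε ≤ 1)
    (x : Fin n → S) (w : Fin n → ℝ) :
    deviation μ ε g x w ≤ b ^ 2 + 2 * meanSq w := by
  have h1 := l2NormSq_le (μ := μ) hg hgb
  have h2 : -meanSq w ≤ (1 / (n : ℝ)) * ∑ i, (g (x i) ^ 2 - 2 * w i * g (x i)) := by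
    rw [meanSq, ← mul_neg, ← Finset.sum_neg_distrib]
    gcongr with i
    nlinarith [sq_nonneg (g (x i) - w i)]
  have hV : 0 ≤ meanSq w := by unfold meanSq; positivity
  simp only [deviation]
  nlinarith [mul_le_mul_of_nonneg_left h2 (by linarith : 0 ≤ 1 + ε)]

end Deterministic

/-! ### Linear combinations, vertices of the ball and the residual. -/

section LinComb

variable {S : Type*} {M : ℕ}

lemma measurable_linComb_sub [MeasurableSpace S] {f : S → ℝ} {fs : Fin M → S → ℝ}
    (hf : Measurable f) (hfs : ∀ j, Measurable (fs j)) (lam : Fin M → ℝ) :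
    Measurable fun x => linComb fs lam x - f x := by
  unfold linComb; fun_prop

lemma abs_linComb_le {fs : Fin M → S → ℝ} {L : ℝ} (hfs : ∀ j x, |fs j x| ≤ L)
    (lam : Fin M → ℝ) (x : S) : |linComb fs lam x| ≤ (∑ j, |lam j|) * L := by
  rw [linComb, Finset.sum_mul]
  refine (Finset.abs_sum_le_sum_abs _ _).trans (Finset.sum_le_sum fun j _ => ?_)
  rw [abs_mul]
  exact mul_le_mul_of_nonneg_left (hfs j x) (abs_nonneg _)

lemma abs_linComb_sub_le {f : S → ℝ} {fs : Fin M → S → ℝ} {L T : ℝ} (hL : 0 ≤ L)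
    (hf : ∀ x, |f x| ≤ L) (hfs : ∀ j x, |fs j x| ≤ L) {lam : Fin M → ℝ}
    (hlam : lam ∈ l1Ball M T) (x : S) : |linComb fs lam x - f x| ≤ L * (T + 1) := by
  have h1 := abs_linComb_le hfs lam x
  have h2 : (∑ j, |lam j|) * L ≤ T * L := mul_le_mul_of_nonneg_right hlam hL
  have h3 := abs_sub (linComb fs lam x) (f x)
  linarith [hf x]

lemma linComb_sub_linComb (fs : Fin M → S → ℝ) (lam lam' : Fin M → ℝ) (x : S) :
    linComb fs lam x - linComb fs lam' x = linComb fs (fun j => lam j - lam' j) x := by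
  simp only [linComb, ← Finset.sum_sub_distrib, sub_mul]

lemma linComb_single (fs : Fin M → S → ℝ) (j : Fin M) :
    linComb fs (Pi.single j 1) = fs j := by
  ext x
  simp [linComb, Pi.single_apply]

lemma numNonzero_single (j : Fin M) : numNonzero (Pi.single j 1 : Fin M → ℝ) = 1 := by
  have : (Finset.univ.filter fun i => (Pi.single j 1 : Fin M → ℝ) i ≠ 0) = {j} := by
    ext i
    simp [Pi.single_apply]
  rw [numNonzero, this, Finset.card_singleton]

lemma single_mem_l1Ball {T : ℝ} (hT : 1 ≤ T) (j : Fin M) :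
    (Pi.single j 1 : Fin M → ℝ) ∈ l1Ball M T := by
  have : ∑ i, |(Pi.single j 1 : Fin M → ℝ) i| = 1 := by
    rw [Finset.sum_eq_single j] <;> simp +contextual
  simpa [l1Ball, this] using hT

lemma penalty_eq (K₁ : ℝ) (n : ℕ) (lam : Fin M → ℝ) :
    penalty K₁ n lam = K₁ / n * complexity (max (M : ℝ) n) (numNonzero lam) := by
  rw [penalty, complexity]; ring

lemma residual_eq {n : ℕ} (f : S → ℝ) (fs : Fin M → S → ℝ) (x : Fin n → S)
    (w : Fin n → ℝ) (lam : Fin M → ℝ) :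
    residual fs x (fun i => f (x i) + w i) lam = meanSq w + (1 / (n : ℝ)) *
      ∑ i, ((linComb fs lam (x i) - f (x i)) ^ 2 - 2 * w i * (linComb fs lam (x i) - f (x i))) := by
  rw [residual, meanSq, ← mul_add, ← Finset.sum_add_distrib]
  congr 1
  exact Finset.sum_congr rfl fun i _ => by ring

end LinComb

/-! ### Uniform control of the deviation by the penalty. -/

/-- The right side does not depend on `lam`, so the bound applies to a data-dependent minimizer. The
sum of positive parts plays the role of a union bound over the grid. -/
lemma deviation_sub_penalty_le {S : Type*} [MeasurableSpace S] {μ : Measure S}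
    [IsProbabilityMeasure μ] {n M : ℕ} (hn : 1 ≤ n) {f : S → ℝ} {fs : Fin M → S → ℝ}
    (hf : Measurable f) (hfs : ∀ j, Measurable (fs j)) {L T : ℝ} (hL : 0 ≤ L) (hT : 1 ≤ T)
    (hfL : ∀ x, |f x| ≤ L) (hfsL : ∀ j x, |fs j x| ≤ L) {ε v K₁ : ℝ} (hε : 0 < ε) (hε1 : ε ≤ 1)
    (hv : 0 ≤ v) (hK : 24 * (v + (L * (T + 1)) ^ 2) ≤ K₁) {lam : Fin M → ℝ}
    (hlam : lam ∈ l1Ball M T) (x : Fin n → S) (w : Fin n → ℝ) :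
    deviation μ ε (fun x => linComb fs lam x - f x) x w - (1 + ε) * penalty K₁ n lam
      ≤ ∑ a ∈ intL1Ball n M, max (deviation μ ε (fun x => linComb fs (gridPoint T n a) x - f x) x w
          - K₁ / (2 * n) * complexity (max (M : ℝ) n) (intSupport a)) 0
        + 2 * max (meanSq w - 2 * v) 0 := by
  set m : ℝ := max (M : ℝ) n with hm
  set b : ℝ := L * (T + 1) with hb_def
  set k := numNonzero lam with hk
  have hn' : (0 : ℝ) < n := by exact_mod_cast hn
  have hb : 0 ≤ b := by positivity
  have hK0 : 0 ≤ K₁ := le_trans (by positivity) hK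
  have hm0 : 0 ≤ m := (Nat.cast_nonneg n).trans (le_max_right _ _)
  have hkM : (k : ℝ) ≤ M := by
    have : k ≤ M := (Finset.card_filter_le _ _).trans_eq (by simp)
    exact_mod_cast this
  have hkm : (k : ℝ) ≤ m := hkM.trans (le_max_left _ _)
  have hC := mul_log_two_le_complexity hkm
  have hC0 := complexity_nonneg hm0 k
  have hl2 : (2 / 3 : ℝ) ≤ Real.log 2 := by linarith [Real.log_two_gt_d9]
  have hpen : K₁ / n * complexity m k ≤ (1 + ε) * penalty K₁ n lam := by
    rw [penalty_eq]
    have : 0 ≤ K₁ / n * complexity m k := by positivity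
    nlinarith
  have hV : 0 ≤ meanSq w := by unfold meanSq; positivity
  have hmax1 := le_max_left (meanSq w - 2 * v) 0
  have hmax0 := le_max_right (meanSq w - 2 * v) 0
  have hmeas := measurable_linComb_sub hf hfs
  have hbd : ∀ lam' ∈ l1Ball M T, ∀ x, |linComb fs lam' x - f x| ≤ b :=
    fun lam' h' => abs_linComb_sub_le hL hfL hfsL h'
  have hκ0 : (0 : ℝ) ≤ k / n := by positivity
  -- Here 24 · (2/3) = 16, as log 2 ≥ 2/3. Half of this, 8(v + b²)k/n, covers the rounding cost (8b²
  -- + 4v)k/n.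
  have hcost : 16 * (v + b ^ 2) * (k / n) ≤ K₁ / n * complexity m k := by
    have h1 : K₁ / n * (k * (2 / 3)) ≤ K₁ / n * complexity m k := by
      refine mul_le_mul_of_nonneg_left (le_trans ?_ hC) (by positivity)
      gcongr
    have h2 := mul_le_mul_of_nonneg_right hK hκ0
    have e : K₁ / n * (k * (2 / 3)) = 2 / 3 * (K₁ * (k / n)) := by ring
    linarith
  -- For k ≤ n the factor k/n ≤ 1 keeps the noise excess bounded; for k > n the penalty alone
  -- exceeds the crude bound.
  rcases le_or_gt (k : ℝ) n with hkn | hkn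
  · obtain ⟨a, ha, hak, had⟩ := exists_gridPoint hn (by linarith : 0 < T) hlam
    have hsingle := Finset.single_le_sum (f := fun a =>
      max (deviation μ ε (fun x => linComb fs (gridPoint T n a) x - f x) x w
          - K₁ / (2 * n) * complexity m (intSupport a)) 0) (fun a _ => le_max_right _ _) ha
    have hterm := le_max_left (deviation μ ε (fun x => linComb fs (gridPoint T n a) x - f x) x w
          - K₁ / (2 * n) * complexity m (intSupport a)) 0
    have hclose : ∀ x, |(linComb fs lam x - f x) - (linComb fs (gridPoint T n a) x - f x)|
        ≤ b * (k / n) := by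
      intro x
      rw [sub_sub_sub_cancel_right, linComb_sub_linComb]
      refine (abs_linComb_le hfsL _ x).trans ((mul_le_mul_of_nonneg_right had hL).trans ?_)
      have : L * T ≤ b := by rw [hb_def]; linarith
      calc (k : ℝ) * (T / n) * L = (L * T) * (k / n) := by ring
        _ ≤ b * (k / n) := by gcongr
    have hdev := deviation_le_of_abs_sub_le (μ := μ) hn (hmeas lam) (hmeas (gridPoint T n a)) hb hκ0
      (hbd lam hlam) (hbd _ (gridPoint_mem hn (by linarith) ha)) hclose hε hε1 x w
    have hmono : K₁ / (2 * n) * complexity m (intSupport a) ≤ K₁ / (2 * n) * complexity m k :=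
      mul_le_mul_of_nonneg_left (complexity_mono hm0 hak) (by positivity)
    have hhalf : K₁ / (2 * n) * complexity m k = (K₁ / n * complexity m k) / 2 := by
      field_simp
    have hkn1 : (k : ℝ) / n ≤ 1 := (div_le_one hn').2 hkn
    have hnoise : k / n * (2 * meanSq w) ≤ k / n * (4 * v) + 2 * max (meanSq w - 2 * v) 0 := by
      nlinarith [mul_le_mul_of_nonneg_left hmax1 hκ0, mul_le_mul_of_nonneg_right hkn1 hmax0]
    have hvκ : 0 ≤ v * (k / n) := mul_nonneg hv hκ0
    linarith
  · have hsum : 0 ≤ ∑ a ∈ intL1Ball n M,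
        max (deviation μ ε (fun x => linComb fs (gridPoint T n a) x - f x) x w
          - K₁ / (2 * n) * complexity m (intSupport a)) 0 :=
      Finset.sum_nonneg fun a _ => le_max_right _ _
    have hdev := deviation_le (μ := μ) hn (hmeas lam) (hbd lam hlam) hε hε1 x w
    have hkn1 : 1 ≤ (k : ℝ) / n := (one_le_div hn').2 hkn.le
    have : 16 * (v + b ^ 2) * 1 ≤ 16 * (v + b ^ 2) * (k / n) := by gcongr
    nlinarith [sq_nonneg b]

/-! ### Expectations and the oracle inequality. -/

section Expectation

variable {Ω S : Type*} [MeasurableSpace Ω] [MeasurableSpace S] {n : ℕ} {P : Measure Ω}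
  [IsProbabilityMeasure P] {μ : Measure S} {σ : ℝ} {X : Fin n → Ω → S} {W : Fin n → Ω → ℝ}

/-- The cross term has mean zero because W_i is centred and independent of X_i. This is applied to
the fixed competitor f_j − f. -/
lemma IsGaussianRandomDesign.integral_contrast (h : IsGaussianRandomDesign P μ σ X W)
    (hn : 1 ≤ n) {g : S → ℝ} (hg : Measurable g) {b : ℝ} (hb : ∀ x, |g x| ≤ b) :
    Integrable (fun ω => (1 / (n : ℝ)) * ∑ i, (g (X i ω) ^ 2 - 2 * W i ω * g (X i ω))) P ∧
      ∫ ω, (1 / (n : ℝ)) * ∑ i, (g (X i ω) ^ 2 - 2 * W i ω * g (X i ω)) ∂P = l2NormSq μ g := by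
  have hn' : (n : ℝ) ≠ 0 := by positivity
  have hX := h.measurable_design
  have hgX : ∀ i, Measurable fun ω => g (X i ω) := fun i => hg.comp (hX i)
  have hIsq : ∀ i, Integrable (fun ω => g (X i ω) ^ 2) P := fun i =>
    integrable_sq_of_abs_le (hgX i) fun ω => hb _
  have hIg : ∀ i, Integrable (fun ω => g (X i ω)) P := fun i =>
    Integrable.of_bound (hgX i).aestronglyMeasurable b (ae_of_all _ fun ω => hb _)
  have hIW : ∀ i, Integrable (W i) P := by
    intro i
    have : Integrable id (P.map (W i)) := by
      rw [h.law_error i]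
      exact memLp_one_iff_integrable.1 (memLp_id_gaussianReal 1)
    exact this.comp_measurable (h.measurable_error i)
  have hind : ∀ i, IndepFun (W i) (fun ω => g (X i ω)) P := by
    intro i
    have h1 : Measurable fun x : Fin n → S => g (x i) := hg.comp (measurable_pi_apply i)
    have h2 : Measurable fun w : Fin n → ℝ => w i := measurable_pi_apply i
    exact (h.indep_design_error.comp h1 h2).symm
  have hIWg : ∀ i, Integrable (fun ω => W i ω * g (X i ω)) P := fun i =>
    (hind i).integrable_mul (hIW i) (hIg i)
  have hEW : ∀ i, ∫ ω, W i ω ∂P = 0 := by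
    intro i
    have := integral_map (μ := P) (h.measurable_error i).aemeasurable
      (f := fun w : ℝ => w) aestronglyMeasurable_id
    rw [← this, h.law_error i, integral_id_gaussianReal]
  have hEWg : ∀ i, ∫ ω, W i ω * g (X i ω) ∂P = 0 := by
    intro i
    rw [(hind i).integral_fun_mul_eq_mul_integral (hIW i).aestronglyMeasurable
      (hIg i).aestronglyMeasurable, hEW i, zero_mul]
  have hterm : ∀ i, Integrable (fun ω => g (X i ω) ^ 2 - 2 * W i ω * g (X i ω)) P := by
    intro i
    refine (hIsq i).sub (((hIWg i).const_mul 2).congr (ae_of_all _ fun ω => ?_))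
    simp only; ring
  refine ⟨(integrable_finsetSum _ fun i _ => hterm i).const_mul _, ?_⟩
  rw [integral_const_mul, integral_finsetSum _ fun i _ => hterm i]
  have hE : ∀ i, ∫ ω, g (X i ω) ^ 2 - 2 * W i ω * g (X i ω) ∂P = l2NormSq μ g := by
    intro i
    have e : ∀ ω, 2 * W i ω * g (X i ω) = 2 * (W i ω * g (X i ω)) := fun ω => by ring
    simp_rw [e]
    rw [integral_sub (hIsq i) ((hIWg i).const_mul 2), integral_const_mul, hEWg i, mul_zero,
      sub_zero, l2NormSq, ← h.law_design i, integral_map (hX i).aemeasurable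
        (hg.pow_const 2).aestronglyMeasurable]
  simp only [hE, Finset.sum_const, Finset.card_univ, Fintype.card_fin, nsmul_eq_mul]
  field_simp

lemma IsGaussianRandomDesign.integral_deviation_excess_le [IsProbabilityMeasure μ]
    (h : IsGaussianRandomDesign P μ σ X W)
    (hn : 1 ≤ n) {g : S → ℝ} (hg : Measurable g) {b : ℝ} (hb : ∀ x, |g x| ≤ b)
    {ε t q : ℝ} (hε : 0 < ε) (hε1 : ε ≤ 1) (ht : 0 < t) (hts : t * (16 * (σ ^ 2 + b ^ 2)) ≤ ε) :
    Integrable (fun ω => max (deviation μ ε g (fun i => X i ω) (fun i => W i ω) - q) 0) P ∧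
      ∫ ω, max (deviation μ ε g (fun i => X i ω) (fun i => W i ω) - q) 0 ∂P
        ≤ Real.exp (-(n * t * q)) / (n * t) := by
  have hn' : (0 : ℝ) < n := by exact_mod_cast hn
  have hX := h.measurable_design
  have hW := h.measurable_error
  have hgX : ∀ i, Measurable fun ω => g (X i ω) := fun i => hg.comp (hX i)
  have hs : 0 < n * t := by positivity
  refine integrable_and_integral_le_of_lintegral (by unfold deviation; fun_prop)
    (fun ω => le_max_right _ _) (by positivity) ?_
  have hle : ∀ ω, ENNReal.ofReal
      (max (deviation μ ε g (fun i => X i ω) (fun i => W i ω) - q) 0)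
      ≤ ENNReal.ofReal (Real.exp (-(n * t * q)) / (n * t)) * ENNReal.ofReal (Real.exp
        (n * t * deviation μ ε g (fun i => X i ω) (fun i => W i ω))) := by
    intro ω
    rw [← ENNReal.ofReal_mul (by positivity)]
    refine ENNReal.ofReal_le_ofReal ((max_zero_le_exp_div hs _).trans_eq ?_)
    rw [div_mul_eq_mul_div, ← Real.exp_add]
    congr 2
    ring
  refine (lintegral_mono hle).trans ?_
  rw [lintegral_const_mul _ (by unfold deviation; fun_prop)]
  exact mul_le_of_le_one_right' (lintegral_exp_deviation_le_one hn h hg hb hε hε1 ht.le hts)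

lemma measurable_l2NormSq_linComb_sub [SFinite μ] {M : ℕ} {f : S → ℝ} {fs : Fin M → S → ℝ}
    (hf : Measurable f) (hfs : ∀ j, Measurable (fs j)) {lamHat : Ω → Fin M → ℝ}
    (hl : Measurable lamHat) :
    Measurable fun ω => l2NormSq μ fun x => linComb fs (lamHat ω) x - f x := by
  have hl' : ∀ j, Measurable fun ω => lamHat ω j := fun j => (measurable_pi_apply j).comp hl
  have : StronglyMeasurable (Function.uncurry fun (ω : Ω) (x : S) =>
      (linComb fs (lamHat ω) x - f x) ^ 2) := by
    refine Measurable.stronglyMeasurable ?_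
    simp only [Function.uncurry_def, linComb]
    have h1 : ∀ j, Measurable fun p : Ω × S => lamHat p.1 j := fun j => (hl' j).comp measurable_fst
    have h2 : ∀ j, Measurable fun p : Ω × S => fs j p.2 := fun j => (hfs j).comp measurable_snd
    have h3 : Measurable fun p : Ω × S => f p.2 := hf.comp measurable_snd
    fun_prop
  exact this.integral_prod_right.measurable

/-- The oracle inequality for the penalized least squares estimate with explicit constants. -/
theorem IsGaussianRandomDesign.integral_l2NormSq_penalizedLSE_le
    [IsProbabilityMeasure μ] (h : IsGaussianRandomDesign P μ σ X W) (hσ : 0 < σ) (hn : 1 ≤ n) {M : ℕ}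
    {f : S → ℝ} {fs : Fin M → S → ℝ} (hf : Measurable f) (hfs : ∀ j, Measurable (fs j))
    {L T : ℝ} (hL : 0 ≤ L) (hT : 1 ≤ T) (hfL : ∀ x, |f x| ≤ L) (hfsL : ∀ j x, |fs j x| ≤ L)
    {ε K₁ : ℝ} (hε : 0 < ε) (hε1 : ε ≤ 1)
    (hK : 224 * (σ ^ 2 + (L * (T + 1)) ^ 2) / ε ≤ K₁)
    {lamHat : Ω → Fin M → ℝ} (hl : Measurable lamHat)
    (hmin : ∀ ω, IsPenalizedLSE K₁ T fs (fun i => X i ω)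
      (fun i => f (X i ω) + W i ω) (lamHat ω)) (j : Fin M) :
    Integrable (fun ω => l2NormSq μ fun x => linComb fs (lamHat ω) x - f x) P ∧
      ∫ ω, l2NormSq μ (fun x => linComb fs (lamHat ω) x - f x) ∂P
        ≤ (1 + ε) * l2NormSq μ (fun x => fs j x - f x)
          + (2 * K₁ * Real.log (1 + max (M : ℝ) n)
            + 32 * (σ ^ 2 + (L * (T + 1)) ^ 2) / ε + 8 * σ ^ 2) / n := by
  set b : ℝ := L * (T + 1) with hb_def
  set m : ℝ := max (M : ℝ) n with hm
  have hn' : (0 : ℝ) < n := by exact_mod_cast hn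
  have hM : 1 ≤ M := Fin.pos j
  have hm0 : 0 ≤ m := (Nat.cast_nonneg n).trans (le_max_right _ _)
  set Q : ℝ := σ ^ 2 + b ^ 2 with hQ
  have hQ0 : 0 < Q := by positivity
  have hK0 : 0 < K₁ := lt_of_lt_of_le (by positivity) hK
  have hK24 : 24 * (σ ^ 2 + b ^ 2) ≤ K₁ := by
    refine le_trans ?_ hK
    rw [le_div_iff₀ hε]
    nlinarith
  have hmeas := measurable_linComb_sub hf hfs
  have hbd : ∀ lam' ∈ l1Ball M T, ∀ x, |linComb fs lam' x - f x| ≤ b :=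
    fun lam' h' => abs_linComb_sub_le hL hfL hfsL h'
  have hint : Integrable (fun ω => l2NormSq μ fun x => linComb fs (lamHat ω) x - f x) P := by
    refine Integrable.of_bound (measurable_l2NormSq_linComb_sub hf hfs hl).aestronglyMeasurable
      (b ^ 2) (ae_of_all _ fun ω => ?_)
    rw [Real.norm_eq_abs, abs_of_nonneg (l2NormSq_nonneg _ _)]
    exact l2NormSq_le (hmeas _) (hbd _ (hmin ω).1)
  refine ⟨hint, ?_⟩
  set t : ℝ := ε / (16 * Q) with ht
  have ht0 : 0 < t := by positivity
  have hts : t * (16 * (σ ^ 2 + b ^ 2)) ≤ ε := by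
    rw [ht, ← hQ]; field_simp; exact le_rfl
  -- The constant 224 = 16 · 14 is chosen here: half of the penalty then yields the exponent 7 that
  -- the weighted count requires.
  have htK : 14 ≤ t * K₁ := by
    have := mul_le_mul_of_nonneg_left hK ht0.le
    refine le_trans (le_of_eq ?_) this
    rw [ht]; field_simp; norm_num
  set D : Ω → ℝ := fun ω => (1 / (n : ℝ)) * ∑ i, ((fs j (X i ω) - f (X i ω)) ^ 2
    - 2 * W i ω * (fs j (X i ω) - f (X i ω))) with hD
  set E : (Fin M → ℤ) → Ω → ℝ := fun a ω =>
    max (deviation μ ε (fun x => linComb fs (gridPoint T n a) x - f x) (fun i => X i ω)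
      (fun i => W i ω) - K₁ / (2 * n) * complexity m (intSupport a)) 0 with hE
  set V : Ω → ℝ := fun ω => max (meanSq (fun i => W i ω) - 2 * σ ^ 2) 0 with hV
  have hj := hbd _ (single_mem_l1Ball hT j)
  rw [linComb_single] at hj
  have hg : Measurable fun x => fs j x - f x := (hfs j).sub hf
  have hDie := h.integral_contrast hn hg hj
  have hDi : Integrable D P := hDie.1
  have hDe : ∫ ω, D ω ∂P = l2NormSq μ fun x => fs j x - f x := hDie.2
  obtain ⟨hVi, hVe⟩ := integral_meanSq_excess_le hn hσ h
  have hEa : ∀ a ∈ intL1Ball n M, Integrable (E a) P ∧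
      ∫ ω, E a ω ∂P ≤ Real.exp (-(7 * complexity m (intSupport a))) / (n * t) := by
    intro a ha
    obtain ⟨h1, h2⟩ := h.integral_deviation_excess_le hn (hmeas (gridPoint T n a))
      (hbd _ (gridPoint_mem hn (by linarith) ha)) (q := K₁ / (2 * n) * complexity m (intSupport a))
      hε hε1 ht0 hts
    refine ⟨h1, h2.trans ?_⟩
    refine div_le_div_of_nonneg_right (Real.exp_le_exp.2 (neg_le_neg ?_)) (by positivity)
    have e : n * t * (K₁ / (2 * n) * complexity m (intSupport a))
        = (t * K₁) / 2 * complexity m (intSupport a) := by field_simp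
    rw [e]
    have := complexity_nonneg hm0 (intSupport a)
    gcongr
    linarith
  -- Minimality against the vertex e_j: the common term `meanSq` cancels, and one non-zero
  -- coefficient costs K₁ log(1 + m) / n.
  have hpt : ∀ ω, l2NormSq μ (fun x => linComb fs (lamHat ω) x - f x)
      ≤ (1 + ε) * D ω + (1 + ε) * (K₁ / n * Real.log (1 + m))
        + ∑ a ∈ intL1Ball n M, E a ω + 2 * V ω := by
    intro ω
    have h1 := deviation_sub_penalty_le (μ := μ) hn hf hfs hL hT hfL hfsL hε hε1 (sq_nonneg σ) hK24
      (hmin ω).1 (fun i => X i ω) (fun i => W i ω)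
    have h2 := (hmin ω).2 _ (single_mem_l1Ball hT j)
    have h3 := residual_eq f fs (fun i => X i ω) (fun i => W i ω) (lamHat ω)
    have h4 := residual_eq f fs (fun i => X i ω) (fun i => W i ω) (Pi.single j 1)
    rw [linComb_single] at h4
    have h5 : penalty K₁ n (Pi.single j 1 : Fin M → ℝ) = K₁ / n * Real.log (1 + m) := by
      rw [penalty_eq, numNonzero_single, complexity_of_pos _ le_rfl]; simp [hm]
    rw [h3, h4, h5] at h2
    have h6 := mul_le_mul_of_nonneg_left h2 (by linarith : 0 ≤ 1 + ε)
    simp only [deviation] at h1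
    simp only [hD, hE, hV]
    simp only [deviation]
    linarith
  have hsumI : Integrable (fun ω => ∑ a ∈ intL1Ball n M, E a ω) P :=
    integrable_finsetSum _ fun a ha => (hEa a ha).1
  have hsumE : ∫ ω, ∑ a ∈ intL1Ball n M, E a ω ∂P ≤ 2 / (n * t) := by
    rw [integral_finsetSum _ fun a ha => (hEa a ha).1]
    refine (Finset.sum_le_sum fun a ha => (hEa a ha).2).trans ?_
    rw [← Finset.sum_div]
    gcongr
    exact sum_exp_neg_complexity_le_two hn hM
  have hI1 : Integrable (fun ω => (1 + ε) * D ω) P := hDi.const_mul _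
  have hI2 : Integrable (fun ω => (1 + ε) * D ω + (1 + ε) * (K₁ / n * Real.log (1 + m))) P :=
    hI1.add (integrable_const _)
  have hI3 : Integrable (fun ω => (1 + ε) * D ω + (1 + ε) * (K₁ / n * Real.log (1 + m))
      + ∑ a ∈ intL1Ball n M, E a ω) P := hI2.add hsumI
  have hI4 : Integrable (fun ω => 2 * V ω) P := hVi.const_mul 2
  have hmono := integral_mono hint (hI3.add hI4) hpt
  simp only [Pi.add_apply] at hmono
  rw [integral_add hI3 hI4, integral_add hI2 hsumI, integral_add hI1 (integrable_const _),
    integral_const_mul (1 + ε) D, integral_const_mul 2 V, hDe] at hmono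
  simp only [integral_const, probReal_univ, one_smul] at hmono
  have hlog : 0 ≤ Real.log (1 + m) := Real.log_nonneg (by linarith)
  have h7 : (1 + ε) * (K₁ / n * Real.log (1 + m)) ≤ 2 * (K₁ / n * Real.log (1 + m)) := by
    have : 0 ≤ K₁ / n * Real.log (1 + m) := by positivity
    nlinarith
  have h8 : 2 / (n * t) = 32 * Q / ε / n := by rw [ht]; field_simp; norm_num
  have h9 : (2 * K₁ * Real.log (1 + m) + 32 * Q / ε + 8 * σ ^ 2) / n
      = 2 * (K₁ / n * Real.log (1 + m)) + 32 * Q / ε / n + 2 * (4 * σ ^ 2 / n) := by ring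
  rw [h9]
  rw [h8] at hsumE
  linarith

end Expectation

end Aggregation
-- The corollary: choice of threshold and constant.
theorem corollary3p7 :
    ∃ Kstar : ℝ → ℝ → ℝ → ℝ,
      (∀ ε B v : ℝ, 0 < ε → 0 ≤ B → 0 < v → 0 < Kstar ε B v) ∧
      ∀ R : ℝ, 1 ≤ R → ∃ c : ℝ, 0 < c ∧
        ∀ (σ L T B : ℝ), 0 < σ → 1 ≤ T → B = L ^ 2 * (T + 1) ^ 2 →
        ∀ (ε : ℝ), 0 < ε →
        ∀ (K₁ : ℝ), Kstar ε B (σ ^ 2) ≤ K₁ → K₁ ≤ R * Kstar ε B (σ ^ 2) →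
        ∀ (n M : ℕ), 1 ≤ n → 2 ≤ M →
        ∀ (d : ℕ) (𝒳 : Set (EuclideanSpace ℝ (Fin d))), MeasurableSet 𝒳 →
        ∀ (μ : Measure 𝒳) [IsProbabilityMeasure μ]
          (f : 𝒳 → ℝ) (fs : Fin M → 𝒳 → ℝ),
          Measurable f → (∀ j, Measurable (fs j)) →
          (∀ x, |f x| ≤ L) → (∀ j x, |fs j x| ≤ L) →
        ∀ (Ω : Type*) [MeasurableSpace Ω] (P : Measure Ω) [IsProbabilityMeasure P]
          (X : Fin n → Ω → 𝒳) (W : Fin n → Ω → ℝ),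
          Aggregation.IsGaussianRandomDesign P μ σ X W →
        ∀ (lamHat : Ω → Fin M → ℝ), Measurable lamHat →
          (∀ ω, Aggregation.IsPenalizedLSE K₁ T fs (fun i => X i ω)
            (fun i => f (X i ω) + W i ω) (lamHat ω)) →
          Integrable (fun ω => Aggregation.l2NormSq μ
            (fun x => Aggregation.linComb fs (lamHat ω) x - f x)) P ∧
          ∫ ω, Aggregation.l2NormSq μ
              (fun x => Aggregation.linComb fs (lamHat ω) x - f x) ∂P ≤
            (1 + ε) * (⨅ j : Fin M, Aggregation.l2NormSq μ (fun x => fs j x - f x)) +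
              (c * (1 + B / σ ^ 2)) * σ ^ 2 * (1 + 1 / ε) *
                (Real.log (max (M : ℝ) (n : ℝ)) / (n : ℝ)) := by
  -- The oracle inequality is proved for ε ≤ 1, so it is applied with min ε 1; this only strengthens
  -- the leading factor, and 1 / min ε 1 ≤ 1 + 1/ε.
  refine ⟨fun ε B v => 224 * (v + B) / min ε 1, ?_, ?_⟩
  · intro ε B v hε hB hv
    have : 0 < min ε 1 := lt_min hε one_pos
    positivity
  intro R hR
  -- The terms below add up to 4 · 224 + 2 · (32 + 8) = 976 times R.
  refine ⟨1000 * R, by positivity, ?_⟩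
  intro σ L T B hσ hT hB ε hε K₁ hK hKR n M hn hM d 𝒳 _ μ _ f fs hf hfs hfL hfsL Ω _ P _ X W h
    lamHat hl hmin
  have : NeZero M := ⟨by omega⟩
  obtain ⟨x₀⟩ : Nonempty 𝒳 := nonempty_of_isProbabilityMeasure μ
  have hL : 0 ≤ L := (abs_nonneg _).trans (hfL x₀)
  have hB' : B = (L * (T + 1)) ^ 2 := by rw [hB]; ring
  set e := min ε 1 with he
  have he0 : 0 < e := lt_min hε one_pos
  obtain ⟨j, hj⟩ := exists_eq_ciInf_of_finite
    (f := fun j : Fin M => Aggregation.l2NormSq μ fun x => fs j x - f x)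
  obtain ⟨hint, hle⟩ := h.integral_l2NormSq_penalizedLSE_le hσ hn hf hfs hL hT hfL hfsL he0
    (min_le_right _ _) (by rw [← hB']; exact hK) hl hmin j
  refine ⟨hint, hle.trans ?_⟩
  rw [← hj, ← hB']
  have hn' : (0 : ℝ) < n := by exact_mod_cast hn
  have hσ2 : 0 < σ ^ 2 := by positivity
  have hB0 : 0 ≤ B := by rw [hB']; positivity
  set m : ℝ := max (M : ℝ) n with hm
  -- M ≥ 2 enters here: it gives log m ≥ 1/2, which absorbs the terms without a logarithm, and 1 + m
  -- ≤ m².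
  have hm2 : 2 ≤ m := le_trans (by exact_mod_cast hM) (le_max_left _ _)
  have hl1 : 1 / 2 ≤ Real.log m := by
    have := Real.log_le_log two_pos hm2
    linarith [Real.log_two_gt_d9]
  have hl2 : Real.log (1 + m) ≤ 2 * Real.log m := by
    have := Real.log_le_log (by linarith) (show 1 + m ≤ m ^ 2 by nlinarith)
    rwa [Real.log_pow] at this
  have hE1 : 1 ≤ 1 + 1 / ε := by
    have : 0 ≤ 1 / ε := by positivity
    linarith
  have hinv : 1 / e ≤ 1 + 1 / ε := by
    rcases min_choice ε 1 with h' | h'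
    · rw [he, h']; linarith
    · rw [he, h', div_one]; exact hE1
  set A : ℝ := 1 + 1 / ε with hA
  set Q : ℝ := σ ^ 2 + B with hQ
  have hQ0 : 0 < Q := by positivity
  have hQA : Q / e ≤ Q * A := by
    rw [div_eq_mul_one_div]; gcongr
  have hK0 : 0 ≤ K₁ := le_trans (by positivity) hK
  have hKb : K₁ ≤ 224 * R * (Q * A) := by
    refine hKR.trans ?_
    calc R * (224 * Q / e) = 224 * R * (Q / e) := by ring
      _ ≤ 224 * R * (Q * A) := by gcongr
  have hg0 : 0 ≤ Aggregation.l2NormSq μ fun x => fs j x - f x := Aggregation.l2NormSq_nonneg _ _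
  have hmain : (2 * K₁ * Real.log (1 + m) + 32 * Q / e + 8 * σ ^ 2) / n
      ≤ 1000 * R * (1 + B / σ ^ 2) * σ ^ 2 * A * (Real.log m / n) := by
    have e1 : 1000 * R * (1 + B / σ ^ 2) * σ ^ 2 * A * (Real.log m / n)
        = (1000 * R * (Q * A) * Real.log m) / n := by
      rw [hQ]; field_simp
    rw [e1]
    gcongr
    have hQA0 : 0 < Q * A := by positivity
    have hlog0 : 0 ≤ Real.log (1 + m) := Real.log_nonneg (by linarith)
    have p1 : 2 * K₁ * Real.log (1 + m) ≤ 2 * (224 * R * (Q * A)) * (2 * Real.log m) := by gcongr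
    have p2 : Q * A ≤ 2 * (R * (Q * A) * Real.log m) := by
      have q1 : Q * A ≤ R * (Q * A) := le_mul_of_one_le_left hQA0.le hR
      have q2 : R * (Q * A) * (1 / 2) ≤ R * (Q * A) * Real.log m := by gcongr
      linarith
    have p3 : σ ^ 2 ≤ Q * A := by
      have : Q * 1 ≤ Q * A := by gcongr
      linarith
    have p4 : 32 * Q / e ≤ 32 * (Q * A) := by rw [mul_div_assoc]; gcongr
    linarith
  refine add_le_add ?_ hmain
  gcongr
  exact min_le_left _ _
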